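/- Let $P\subset\mathbb{R}^3$ be a convex lattice polyhedron, that is, the convex hull of finitely many points of $\mathbb{Z}^3$. Let $b=|\partial P\cap\mathbb{Z}^3|$ be the number of lattice points on the boundary of $P$ and let $k=|\operatorname{int}(P)\cap\mathbb{Z}^3|$ be the number of lattice points in the (topological) interior of $P$. If $k\ge 1$, then \[ \operatorname{Vol}(P)\ \ge\ \frac{2b+3k-7}{6}, \] where $\operatorname{Vol}$ denotes the three-dimensional Lebesgue measure. -/

import Mathlib

/-- The integer lattice `ℤ^d`, as a subset of `ℝ^d`. -/
def integerLattice (d : ℕ) : Set (Fin d → ℝ) :=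
  Set.range fun (z : Fin d → ℤ) (i : Fin d) => (z i : ℝ)

/-- A convex lattice polytope in `ℝ^d`: the convex hull of finitely many points of `ℤ^d`. -/
def IsConvexLatticePolytope {d : ℕ} (P : Set (Fin d → ℝ)) : Prop :=
  ∃ V : Set (Fin d → ℝ), V.Finite ∧ V ⊆ integerLattice d ∧ P = convexHull ℝ V

open Filter Topology Matrix MeasureTheory
open scoped Pointwise

/-! Six times the volume of a nondegenerate lattice tetrahedron is a nonzero integer in absolute
value, so it suffices to cover `P` by at least 2b + 3k - 7 such tetrahedra whose normalized volumes
|det| sum to at most 6 Vol(P).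

After a translation the origin is an interior lattice point. Positive generic heights on the
boundary lattice points define a complete simplicial fan (`exists_cell_coord_nonneg`). Heights of
the form 1 + τ|v|² with small τ, then perturbed, make every cone lie over a boundary triangle
containing no further boundary lattice point (`exists_heights`). Counting cones by the signs of the
coordinates of a generic vector gives at least 2b - 4 of them (`two_mul_le_card_cells`). The
pyramids from the origin over these triangles cover `P` and overlap only in null sets, whence the
volume bound `sum_abs_det_cells_le`.

The other k - 1 interior lattice points are inserted by star subdivision. Each adds at least three
tetrahedra (`card_add_three_le`) and preserves both the covering and the sum of |det|. Thus
disjointness is needed only for the initial pyramids. -/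

/-- The coordinates of `x` with respect to the rows of `A`. -/
noncomputable def coord {n : ℕ} (A : Matrix (Fin n) (Fin n) ℝ) (x : Fin n → ℝ) : Fin n → ℝ :=
  x ᵥ* A⁻¹

/-! ### Linear algebra of simplicial cones -/

section Coord

variable {n : ℕ} {A : Matrix (Fin n) (Fin n) ℝ}

theorem coord_vecMul_self (hA : A.det ≠ 0) (x : Fin n → ℝ) : coord A x ᵥ* A = x := by
  rw [coord, vecMul_vecMul, nonsing_inv_mul _ (isUnit_iff_ne_zero.2 hA), vecMul_one]

theorem coord_vecMul (hA : A.det ≠ 0) (c : Fin n → ℝ) : coord A (c ᵥ* A) = c := by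
  rw [coord, vecMul_vecMul, mul_nonsing_inv _ (isUnit_iff_ne_zero.2 hA), vecMul_one]

theorem coord_add (x y : Fin n → ℝ) : coord A (x + y) = coord A x + coord A y :=
  add_vecMul _ _ _

theorem coord_sub (x y : Fin n → ℝ) : coord A (x - y) = coord A x - coord A y :=
  sub_vecMul _ _ _

theorem coord_smul (r : ℝ) (x : Fin n → ℝ) : coord A (r • x) = r • coord A x :=
  smul_vecMul _ _ _

theorem coord_neg (x : Fin n → ℝ) : coord A (-x) = -coord A x :=
  neg_vecMul _ _

theorem coord_row (hA : A.det ≠ 0) (i : Fin n) : coord A (A i) = Pi.single i 1 := by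
  rw [← coord_vecMul hA (Pi.single i 1), single_one_vecMul]; rfl

theorem sum_coord_smul (hA : A.det ≠ 0) (x : Fin n → ℝ) : ∑ i, coord A x i • A i = x := by
  conv_rhs => rw [← coord_vecMul_self hA x, vecMul_eq_sum]

theorem exists_coord_pos (hA : A.det ≠ 0) {x : Fin n → ℝ} (hx : 0 ≤ coord A x) (h0 : x ≠ 0) :
    ∃ j, 0 < coord A x j := by
  by_contra! h
  have : coord A x = 0 := le_antisymm h hx
  exact h0 (by rw [← coord_vecMul_self hA x, this, zero_vecMul])

/-- If finitely many simplicial cones cover a short segment leaving `q` in direction `d`, then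
one of them contains `q` and has `d` in its tangent cone at `q`. -/
theorem exists_cone_along {ι : Type*} [Finite ι] (A : ι → Matrix (Fin n) (Fin n) ℝ)
    (q d : Fin n → ℝ) (h : ∀ᶠ ε : ℝ in 𝓝[>] 0, ∃ i, 0 ≤ coord (A i) (q + ε • d)) :
    ∃ i, 0 ≤ coord (A i) q ∧ ∀ j, coord (A i) q j = 0 → 0 ≤ coord (A i) d j := by
  by_contra! H
  have key : ∀ i, ∀ᶠ ε : ℝ in 𝓝[>] 0, ¬ 0 ≤ coord (A i) (q + ε • d) := by
    intro i
    have hlim : ∀ j, Tendsto (fun ε : ℝ => coord (A i) q j + ε * coord (A i) d j) (𝓝[>] 0)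
        (𝓝 (coord (A i) q j)) := by
      intro j
      have : Continuous fun ε : ℝ => coord (A i) q j + ε * coord (A i) d j := by fun_prop
      simpa using (this.tendsto 0).mono_left nhdsWithin_le_nhds
    by_cases hq : 0 ≤ coord (A i) q
    · obtain ⟨j, hj, hd⟩ := H i hq
      filter_upwards [self_mem_nhdsWithin] with ε hε hc
      have := hc j
      rw [coord_add, coord_smul] at this
      simp only [Pi.zero_apply, Pi.add_apply, Pi.smul_apply, smul_eq_mul, hj, zero_add] at this
      exact absurd this (not_le.2 (mul_neg_of_pos_of_neg hε hd))
    · obtain ⟨j, hj⟩ : ∃ j, coord (A i) q j < 0 := by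
        by_contra! h'
        exact hq h'
      filter_upwards [(hlim j).eventually (gt_mem_nhds hj)] with ε hε hc
      have := hc j
      rw [coord_add, coord_smul] at this
      simp only [Pi.zero_apply, Pi.add_apply, Pi.smul_apply, smul_eq_mul] at this
      linarith
  obtain ⟨ε, ⟨i, hi⟩, hε⟩ := (h.and (eventually_all.2 key)).exists
  exact hε i hi

/-- Replacing one generator of a simplicial cone by a point `q` of the cone, in all possible
ways, yields cones which still cover it. -/
theorem exists_updateRow_coord_nonneg (hA : A.det ≠ 0) {q x : Fin n → ℝ} (hq0 : q ≠ 0)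
    (hq : 0 ≤ coord A q) (hx : 0 ≤ coord A x) :
    ∃ j, 0 < coord A q j ∧ 0 ≤ coord (A.updateRow j q) x := by
  obtain ⟨j₀, hj₀⟩ := exists_coord_pos hA hq hq0
  -- Ratio test of the simplex method: subtracting from `x` the smallest quotient times `q` kills
  -- coordinate `j` and keeps the others nonnegative.
  obtain ⟨j, hj, hmin⟩ := (Finset.univ.filter fun j => 0 < coord A q j).exists_min_image
    (fun j => coord A x j / coord A q j) ⟨j₀, by simpa using hj₀⟩
  simp only [Finset.mem_filter, Finset.mem_univ, true_and] at hj hmin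
  refine ⟨j, hj, ?_⟩
  set r := coord A x j / coord A q j with hr
  have hr0 : 0 ≤ r := div_nonneg (hx j) hj.le
  have hdet : (A.updateRow j q).det ≠ 0 := by
    have h := det_updateRow_sum A j (coord A q)
    rw [sum_coord_smul hA q] at h
    rw [h]
    exact mul_ne_zero hj.ne' hA
  set c : Fin n → ℝ := Function.update (coord A x - r • coord A q) j r with hc
  have hcx : c ᵥ* A.updateRow j q = x := by
    rw [vecMul_eq_sum, ← Finset.add_sum_erase _ _ (Finset.mem_univ j)]
    have h1 : ∑ i ∈ Finset.univ.erase j, c i • (A.updateRow j q) i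
        = ∑ i ∈ Finset.univ.erase j, (coord A x i - r * coord A q i) • A i := by
      refine Finset.sum_congr rfl fun i hi => ?_
      have hij := Finset.ne_of_mem_erase hi
      rw [updateRow_ne hij, hc, Function.update_of_ne hij]
      rfl
    have h2 : ∑ i, (coord A x i - r * coord A q i) • A i = x - r • q := by
      simp only [sub_smul, mul_smul, Finset.sum_sub_distrib, ← Finset.smul_sum]
      rw [sum_coord_smul hA, sum_coord_smul hA]
    rw [← Finset.add_sum_erase _ _ (Finset.mem_univ j)] at h2
    have h3 : coord A x j - r * coord A q j = 0 := by
      rw [hr, div_mul_cancel₀ _ hj.ne', sub_self]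
    rw [h3, zero_smul, zero_add] at h2
    change c j • (A.updateRow j q) j + ∑ i ∈ Finset.univ.erase j, c i • (A.updateRow j q) i = x
    rw [h1, h2, updateRow_self, hc, Function.update_self]
    abel
  rw [← hcx, coord_vecMul hdet]
  intro i
  by_cases hij : i = j
  · subst hij
    simpa [hc] using hr0
  · rw [hc, Function.update_of_ne hij]
    simp only [Pi.zero_apply, Pi.sub_apply, Pi.smul_apply, smul_eq_mul, sub_nonneg]
    rcases (hq i).eq_or_lt with h0 | h0
    · simp only [Pi.zero_apply] at h0
      rw [← h0, mul_zero]
      exact hx i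
    · exact (le_div_iff₀ h0).1 (hmin i h0)

/-- Cramer's rule: when `q` is expanded in the rows of `A`, only its `j`-th term survives in the
determinant. -/
theorem det_updateRow_coord (hA : A.det ≠ 0) (q : Fin n → ℝ) (j : Fin n) :
    (A.updateRow j q).det = coord A q j * A.det := by
  have h := det_updateRow_sum A j (coord A q)
  rwa [sum_coord_smul hA q] at h

end Coord

/-! ### Tetrahedral coverings and star subdivision -/

/-- The point `x` in homogeneous coordinates. -/
def homogenize (x : Fin 3 → ℝ) : Fin 4 → ℝ := vecCons 1 x

theorem homogenize_injective : Function.Injective homogenize := fun x y h => by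
  simpa [homogenize] using h

theorem homogenize_ne_zero (x : Fin 3 → ℝ) : homogenize x ≠ 0 := fun h => by
  simpa [homogenize] using congrFun h 0

/-- A family of nondegenerate tetrahedra with vertices in `W` which together cover `P`; the rows of
`A i` are the vertices of the `i`-th tetrahedron in homogeneous coordinates. -/
structure CoversByTetrahedra (P W : Set (Fin 3 → ℝ)) {ι : Type} (A : ι → Matrix (Fin 4) (Fin 4) ℝ) :
    Prop where
  det_ne_zero : ∀ i, (A i).det ≠ 0
  vertex : ∀ i j, ∃ w ∈ W, A i j = homogenize w
  cover : ∀ x ∈ P, ∃ i, 0 ≤ coord (A i) (homogenize x)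

theorem sum_coord_homogenize {A : Matrix (Fin 4) (Fin 4) ℝ} (hA : A.det ≠ 0)
    (hv : ∀ j, ∃ w : Fin 3 → ℝ, A j = homogenize w) (x : Fin 3 → ℝ) :
    ∑ j, coord A (homogenize x) j = 1 := by
  have h := congrFun (sum_coord_smul hA (homogenize x)) 0
  rw [Finset.sum_apply] at h
  simp only [Pi.smul_apply, smul_eq_mul] at h
  have h1 : ∀ j, A j 0 = 1 := fun j => by
    obtain ⟨w, hw⟩ := hv j
    rw [hw]; rfl
  simpa [h1, homogenize] using h

namespace CoversByTetrahedra

variable {P W : Set (Fin 3 → ℝ)} {ι : Type} {A : ι → Matrix (Fin 4) (Fin 4) ℝ}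

theorem sum_coord (h : CoversByTetrahedra P W A) (i : ι) (x : Fin 3 → ℝ) :
    ∑ j, coord (A i) (homogenize x) j = 1 :=
  sum_coord_homogenize (h.det_ne_zero i) (fun j => (h.vertex i j).imp fun _ hw => hw.2) x

/-- Near an interior point `q`, in each direction there is a tetrahedron containing `q`. -/
theorem exists_along [Finite ι] (h : CoversByTetrahedra P W A) {q : Fin 3 → ℝ}
    (hq : q ∈ interior P) (d : Fin 3 → ℝ) :
    ∃ i, 0 ≤ coord (A i) (homogenize q) ∧
      ∀ j, coord (A i) (homogenize q) j = 0 → 0 ≤ coord (A i) (vecCons 0 d) j := by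
  apply exists_cone_along
  have hc : Continuous fun ε : ℝ => q + ε • d := by fun_prop
  have h0 : Tendsto (fun ε : ℝ => q + ε • d) (𝓝[>] 0) (𝓝 q) := by
    simpa using (hc.tendsto 0).mono_left nhdsWithin_le_nhds
  filter_upwards [h0.eventually (mem_interior_iff_mem_nhds.1 hq)] with ε hε
  convert h.cover _ hε using 4
  simp [homogenize]

/-- The direction from the vertex `j` to `q`. -/
theorem exists_direction (h : CoversByTetrahedra P W A) (q : Fin 3 → ℝ) (i : ι) (j : Fin 4) :
    ∃ d : Fin 3 → ℝ, coord (A i) (vecCons 0 d) = coord (A i) (homogenize q) - Pi.single j 1 := by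
  obtain ⟨w, -, hw⟩ := h.vertex i j
  refine ⟨q - w, ?_⟩
  rw [← coord_row (h.det_ne_zero i) j, ← coord_sub, hw]
  simp [homogenize]

/-- The vertices of a tetrahedron `i` that may be replaced by `q` (none if `q` is outside, when
the index `0` serves as a placeholder). -/
noncomputable def replaceable (A : ι → Matrix (Fin 4) (Fin 4) ℝ) (q : Fin 3 → ℝ) (i : ι) :
    Finset (Fin 4) :=
  open Classical in
  if 0 ≤ coord (A i) (homogenize q) then
    Finset.univ.filter fun j => 0 < coord (A i) (homogenize q) j else {0}

/-- Star subdivision of a family of tetrahedra at `q`. -/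
noncomputable def subdivide (A : ι → Matrix (Fin 4) (Fin 4) ℝ) (q : Fin 3 → ℝ)
    (p : Σ i, replaceable A q i) : Matrix (Fin 4) (Fin 4) ℝ :=
  open Classical in
  if 0 ≤ coord (A p.1) (homogenize q) then (A p.1).updateRow p.2 (homogenize q) else A p.1

theorem coord_pos_of_mem_replaceable {q : Fin 3 → ℝ} {i : ι}
    (hq : 0 ≤ coord (A i) (homogenize q)) {j : Fin 4} :
    j ∈ replaceable A q i ↔ 0 < coord (A i) (homogenize q) j := by
  simp [replaceable, hq]

theorem subdivide_covers (h : CoversByTetrahedra P W A) (q : Fin 3 → ℝ) :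
    CoversByTetrahedra P (insert q W) (subdivide A q) where
  det_ne_zero := by
    rintro ⟨i, j, hj⟩
    simp only [subdivide]
    split_ifs with hq
    · rw [det_updateRow_coord (h.det_ne_zero i)]
      exact mul_ne_zero ((coord_pos_of_mem_replaceable hq).1 hj).ne' (h.det_ne_zero i)
    · exact h.det_ne_zero i
  vertex := by
    rintro ⟨i, j, hj⟩ l
    simp only [subdivide]
    obtain ⟨w, hw, e⟩ := h.vertex i l
    split_ifs with hq
    · by_cases hl : l = j
      · subst hl
        exact ⟨q, Set.mem_insert _ _, by rw [updateRow_self]⟩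
      · exact ⟨w, Set.mem_insert_of_mem _ hw, by rw [updateRow_ne hl, e]⟩
    · exact ⟨w, Set.mem_insert_of_mem _ hw, e⟩
  cover := by
    intro x hx
    obtain ⟨i, hi⟩ := h.cover x hx
    by_cases hq : 0 ≤ coord (A i) (homogenize q)
    · obtain ⟨j, hj, hj'⟩ := exists_updateRow_coord_nonneg (h.det_ne_zero i)
        (homogenize_ne_zero q) hq hi
      exact ⟨⟨i, j, (coord_pos_of_mem_replaceable hq).2 hj⟩, by simpa [subdivide, hq] using hj'⟩
    · exact ⟨⟨i, 0, by simp [replaceable, hq]⟩, by simpa [subdivide, hq] using hi⟩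

/-- The pieces of a tetrahedron containing `q` have its volume times the barycentric coordinates of
`q`, and these sum to 1. -/
theorem sum_abs_det_subdivide [Fintype ι] (h : CoversByTetrahedra P W A) (q : Fin 3 → ℝ) :
    ∑ p, |(subdivide A q p).det| = ∑ i, |(A i).det| := by
  rw [Fintype.sum_sigma]
  refine Finset.sum_congr rfl fun i _ => ?_
  by_cases hq : 0 ≤ coord (A i) (homogenize q)
  · have h1 : ∀ j : replaceable A q i, |(subdivide A q ⟨i, j⟩).det|
        = coord (A i) (homogenize q) j * |(A i).det| := fun j => by
      simp only [subdivide, hq, if_true]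
      rw [det_updateRow_coord (h.det_ne_zero i), abs_mul, abs_of_nonneg (hq j)]
    simp only [h1]
    rw [← Finset.sum_mul, Finset.sum_coe_sort (replaceable A q i) (coord (A i) (homogenize q)),
      Finset.sum_subset (Finset.subset_univ _), h.sum_coord, one_mul]
    intro j _ hj
    rw [coord_pos_of_mem_replaceable hq] at hj
    exact le_antisymm (not_lt.1 hj) (hq j)
  · have h1 : replaceable A q i = {0} := by simp [replaceable, hq]
    simp only [subdivide, hq, if_false, Finset.sum_const, Finset.card_univ, Fintype.card_coe, h1,
      Finset.card_singleton, one_smul]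

theorem one_le_card_replaceable (h : CoversByTetrahedra P W A) (q : Fin 3 → ℝ) (i : ι) :
    1 ≤ (replaceable A q i).card := by
  rw [Finset.one_le_card]
  by_cases hq : 0 ≤ coord (A i) (homogenize q)
  · obtain ⟨j, hj⟩ := exists_coord_pos (h.det_ne_zero i) hq (homogenize_ne_zero q)
    exact ⟨j, (coord_pos_of_mem_replaceable hq).2 hj⟩
  · exact ⟨0, by simp [replaceable, hq]⟩

/-- A point with a single positive barycentric coordinate is a vertex, hence in `W`. -/
theorem two_le_card_replaceable (h : CoversByTetrahedra P W A) {q : Fin 3 → ℝ} (hW : q ∉ W) {i : ι}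
    (hq : 0 ≤ coord (A i) (homogenize q)) : 2 ≤ (replaceable A q i).card := by
  by_contra hlt
  have h1 : (replaceable A q i).card = 1 := by
    have := h.one_le_card_replaceable q i
    omega
  obtain ⟨j, hj⟩ := Finset.card_eq_one.1 h1
  have hz : ∀ l, l ≠ j → coord (A i) (homogenize q) l = 0 := fun l hl => by
    have : l ∉ replaceable A q i := by simpa [hj] using hl
    rw [coord_pos_of_mem_replaceable hq] at this
    exact le_antisymm (not_lt.1 this) (hq l)
  have hs := h.sum_coord i q
  rw [Finset.sum_eq_single j (fun l _ hl => hz l hl) (by simp)] at hs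
  have hx := sum_coord_smul (h.det_ne_zero i) (homogenize q)
  rw [Finset.sum_eq_single j (fun l _ hl => by rw [hz l hl, zero_smul]) (by simp), hs, one_smul]
    at hx
  obtain ⟨w, hw, e⟩ := h.vertex i j
  rw [e] at hx
  exact hW (homogenize_injective hx ▸ hw)

end CoversByTetrahedra

/-- Given two independent half-spaces and a further one, some direction leaves the third one and
one of the first two. -/
theorem exists_neg_of_functionals {E : Type*} [AddCommGroup E] [Module ℝ E] (α β μ : E →ₗ[ℝ] ℝ)
    {d₁ d₂ f : E} (h11 : α d₁ = -1) (h12 : α d₂ = 0) (h22 : β d₂ = -1)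
    (hf : μ f = -1) : ∃ z, (α z < 0 ∨ β z < 0) ∧ μ z < 0 := by
  -- Use `d₂` itself if it already leaves the third half-space, tilt it slightly by `f` if it is
  -- parallel to the boundary plane, and otherwise add a large multiple of `-d₂` to `d₁`, which does
  -- not change `α`.
  rcases lt_trichotomy (μ d₂) 0 with h | h | h
  · exact ⟨d₂, Or.inr (by linarith), h⟩
  · have hp : 0 < 1 + |β f| := by positivity
    refine ⟨d₂ + (1 + |β f|)⁻¹ • f, Or.inr ?_, ?_⟩
    · rw [map_add, map_smul, h22, smul_eq_mul, inv_mul_eq_div, neg_add_lt_iff_lt_add, add_zero,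
        div_lt_one hp]
      linarith [le_abs_self (β f)]
    · rw [map_add, map_smul, h, hf, smul_eq_mul, zero_add, mul_neg_one, neg_lt_zero]
      positivity
  · refine ⟨d₁ - ((|μ d₁| + 1) / μ d₂) • d₂, Or.inl ?_, ?_⟩
    · rw [map_sub, map_smul, h11, h12]; norm_num
    · rw [map_sub, map_smul, smul_eq_mul, div_mul_cancel₀ _ h.ne']
      linarith [le_abs_self (μ d₁)]

namespace CoversByTetrahedra

variable {P W : Set (Fin 3 → ℝ)} {ι : Type} {A : ι → Matrix (Fin 4) (Fin 4) ℝ}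

/-- The linear part of a barycentric coordinate. -/
noncomputable def coordDir (M : Matrix (Fin 4) (Fin 4) ℝ) (j : Fin 4) : (Fin 3 → ℝ) →ₗ[ℝ] ℝ where
  toFun d := coord M (vecCons 0 d) j
  map_add' x y := by
    rw [← Pi.add_apply, ← coord_add, cons_add_cons, add_zero]
  map_smul' r x := by
    rw [RingHom.id_apply, ← Pi.smul_apply, ← coord_smul, smul_cons, smul_zero]

theorem exists_not_mem_replaceable {q : Fin 3 → ℝ} {i : ι}
    (hq : 0 ≤ coord (A i) (homogenize q)) (hJ : (replaceable A q i).card ≤ 2) :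
    ∃ j k, j ≠ k ∧ coord (A i) (homogenize q) j = 0 ∧ coord (A i) (homogenize q) k = 0 := by
  have h1 : 1 < (replaceable A q i)ᶜ.card := by
    rw [Finset.card_compl, Fintype.card_fin]
    omega
  obtain ⟨j, hj, k, hk, hjk⟩ := Finset.one_lt_card.1 h1
  rw [Finset.mem_compl, coord_pos_of_mem_replaceable hq, not_lt] at hj hk
  exact ⟨j, k, hjk, le_antisymm hj (hq j), le_antisymm hk (hq k)⟩

theorem exists_coord_eq_zero {q : Fin 3 → ℝ} {i : ι}
    (hq : 0 ≤ coord (A i) (homogenize q)) (hJ : (replaceable A q i).card ≠ 4) :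
    ∃ j, coord (A i) (homogenize q) j = 0 := by
  by_contra! h
  refine hJ ?_
  have : replaceable A q i = Finset.univ := by
    ext j
    simp only [coord_pos_of_mem_replaceable hq, Finset.mem_univ, iff_true]
    exact lt_of_le_of_ne (hq j) (h j).symm
  rw [this]
  rfl

/-- Star subdivision at a new interior point creates at least three more tetrahedra. -/
theorem card_add_three_le [Fintype ι] (h : CoversByTetrahedra P W A) {q : Fin 3 → ℝ}
    (hq : q ∈ interior P) (hW : q ∉ W) :
    Fintype.card ι + 3 ≤ Fintype.card (Σ i, replaceable A q i) := by
  classical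
  have hcard : Fintype.card (Σ i, replaceable A q i)
      = Fintype.card ι + ∑ i, ((replaceable A q i).card - 1) := by
    rw [Fintype.card_sigma, ← Finset.card_univ, Finset.card_eq_sum_ones, ← Finset.sum_add_distrib]
    refine Finset.sum_congr rfl fun i _ => ?_
    have := h.one_le_card_replaceable q i
    rw [Fintype.card_coe]
    omega
  rw [hcard]
  refine Nat.add_le_add_left ?_ _
  have hsum : ∀ s : Finset ι, ∑ i ∈ s, ((replaceable A q i).card - 1)
      ≤ ∑ i, ((replaceable A q i).card - 1) := fun s =>
    Finset.sum_le_sum_of_subset (Finset.subset_univ s)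
  -- A tetrahedron containing `q` gains one less than the number of positive coordinates of `q`. The
  -- gains are 3 inside a tetrahedron, 2 on a facet and 1 on an edge, so up to three distinct
  -- tetrahedra around `q` are needed.
  obtain ⟨i₁, h₁, -⟩ := h.exists_along hq 0
  have c₁ := h.two_le_card_replaceable hW h₁
  by_cases h4 : (replaceable A q i₁).card = 4
  · refine le_trans ?_ (hsum {i₁})
    rw [Finset.sum_singleton, h4]
  obtain ⟨j, hj⟩ := exists_coord_eq_zero h₁ h4
  -- Continuing from vertex `j` past `q` leaves the first tetrahedron, since coordinate `j` vanishes
  -- at `q`.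
  obtain ⟨d, hd⟩ := h.exists_direction q i₁ j
  obtain ⟨i₂, h₂, hd₂⟩ := h.exists_along hq d
  have h12 : i₁ ≠ i₂ := by
    rintro rfl
    have := hd₂ j hj
    rw [hd] at this
    norm_num [hj] at this
  have c₂ := h.two_le_card_replaceable hW h₂
  by_cases h5 : 3 ≤ (replaceable A q i₁).card ∨ 3 ≤ (replaceable A q i₂).card
  · refine le_trans ?_ (hsum {i₁, i₂})
    rw [Finset.sum_pair h12]
    omega
  push Not at h5
  obtain ⟨j, k, hjk, hj, hk⟩ := exists_not_mem_replaceable h₁ (by omega)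
  obtain ⟨l, hl⟩ := exists_coord_eq_zero h₂ (by omega)
  obtain ⟨d₁, e₁⟩ := h.exists_direction q i₁ j
  obtain ⟨d₂, e₂⟩ := h.exists_direction q i₁ k
  obtain ⟨f, e₃⟩ := h.exists_direction q i₂ l
  -- In the edge case, `z` leaves the first two tetrahedra at once, so a third one contains `q`.
  obtain ⟨z, hz, hz'⟩ := exists_neg_of_functionals (coordDir (A i₁) j) (coordDir (A i₁) k)
    (coordDir (A i₂) l) (d₁ := d₁) (d₂ := d₂) (f := f)
    (by simp [coordDir, e₁, hj]) (by simp [coordDir, e₂, hj, hjk]) (by simp [coordDir, e₂, hk])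
    (by simp [coordDir, e₃, hl])
  obtain ⟨i₃, h₃, hd₃⟩ := h.exists_along hq z
  have h13 : i₁ ≠ i₃ := by
    rintro rfl
    rcases hz with hz | hz
    · exact not_le.2 hz (hd₃ j hj)
    · exact not_le.2 hz (hd₃ k hk)
  have h23 : i₂ ≠ i₃ := by
    rintro rfl
    exact not_le.2 hz' (hd₃ l hl)
  have c₃ := h.two_le_card_replaceable hW h₃
  refine le_trans ?_ (hsum {i₁, i₂, i₃})
  rw [Finset.sum_insert (by simp [h12, h13]), Finset.sum_pair h23]
  omega

/-- Inserting finitely many new interior points one after the other. -/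
theorem exists_refinement (s : Finset (Fin 3 → ℝ)) :
    ∀ (ι : Type) [Fintype ι] (W : Set (Fin 3 → ℝ)) (A : ι → Matrix (Fin 4) (Fin 4) ℝ),
      CoversByTetrahedra P W A → ↑s ⊆ interior P → Disjoint (↑s) W →
      ∃ (κ : Type) (_ : Fintype κ) (A' : κ → Matrix (Fin 4) (Fin 4) ℝ),
        CoversByTetrahedra P (↑s ∪ W) A' ∧ ∑ i, |(A' i).det| = ∑ i, |(A i).det| ∧
          Fintype.card ι + 3 * s.card ≤ Fintype.card κ := by
  classical
  induction s using Finset.induction_on with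
  | empty =>
    intro ι _ W A h _ _
    exact ⟨ι, inferInstance, A, by simpa using h, rfl, by simp⟩
  | insert q s hq ih =>
    intro ι _ W A h hs hW
    rw [Finset.coe_insert, Set.insert_subset_iff] at hs
    rw [Finset.coe_insert, Set.disjoint_insert_left] at hW
    obtain ⟨κ, _, A', h1, h2, h3⟩ := ih _ (insert q W) (subdivide A q) (h.subdivide_covers q) hs.2
      (Set.disjoint_insert_right.2 ⟨by simpa using hq, hW.2⟩)
    refine ⟨κ, inferInstance, A', ?_, ?_, ?_⟩
    · rwa [Finset.coe_insert, Set.insert_union, ← Set.union_insert]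
    · rw [h2, h.sum_abs_det_subdivide]
    · rw [Finset.card_insert_of_notMem hq]
      have := h.card_add_three_le hs.1 hW.1
      omega

/-- The number of tetrahedra is bounded by six times their total volume. -/
theorem card_le_sum_abs_det [Fintype ι] (h : CoversByTetrahedra P W A)
    (hW : W ⊆ integerLattice 3) : (Fintype.card ι : ℝ) ≤ ∑ i, |(A i).det| := by
  have h1 : ∀ i, 1 ≤ |(A i).det| := by
    intro i
    have h2 : ∀ j l, ∃ z : ℤ, (z : ℝ) = A i j l := by
      intro j l
      obtain ⟨w, hw, e⟩ := h.vertex i j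
      obtain ⟨z, rfl⟩ := hW hw
      rw [e]
      refine Fin.cases ⟨1, by simp [homogenize]⟩ (fun l => ⟨z l, ?_⟩) l
      simp [homogenize]
    choose Z hZ using h2
    have h3 : A i = (Matrix.of Z).map (Int.castRingHom ℝ) := by
      ext j l
      simp [hZ]
    have h4 : (A i).det = ((Matrix.of Z).det : ℝ) := by
      rw [h3, ← RingHom.mapMatrix_apply, ← RingHom.map_det]
      rfl
    have h5 := h.det_ne_zero i
    rw [h4] at h5 ⊢
    rw [← Int.cast_abs]
    exact_mod_cast Int.one_le_abs (by exact_mod_cast h5)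
  calc (Fintype.card ι : ℝ) = ∑ _i : ι, (1 : ℝ) := by simp
    _ ≤ _ := Finset.sum_le_sum fun i _ => h1 i

end CoversByTetrahedra

/-! ### Simplicial fans from generic heights -/

/-- A nonempty open set is not contained in a finite union of hyperplanes. -/
theorem exists_mem_forall_functional_ne_zero {n : ℕ} {ι : Type*} [Finite ι]
    (φ : ι → (Fin n → ℝ) →ₗ[ℝ] ℝ) (hφ : ∀ i, φ i ≠ 0) {U : Set (Fin n → ℝ)} (hU : IsOpen U)
    (hne : U.Nonempty) : ∃ x ∈ U, ∀ i, φ i x ≠ 0 := by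
  by_contra! h
  have h1 : U ⊆ ⋃ i, ((LinearMap.ker (φ i) : Submodule ℝ (Fin n → ℝ)) : Set (Fin n → ℝ)) := by
    intro x hx
    obtain ⟨i, hi⟩ := h x hx
    exact Set.mem_iUnion.2 ⟨i, hi⟩
  have h2 : MeasureTheory.volume U = 0 :=
    MeasureTheory.measure_mono_null h1 (MeasureTheory.measure_iUnion_null fun i =>
      MeasureTheory.Measure.addHaar_submodule _ _ (by rw [Ne, LinearMap.ker_eq_top]; exact hφ i))
  exact (hU.measure_pos _ hne).ne' h2

section Fan

variable {b : ℕ} (v : Fin b → Fin 3 → ℝ)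

/-- The matrix whose rows are the generators of the cone indexed by `t`. -/
def coneMatrix (t : Fin 3 → Fin b) : Matrix (Fin 3) (Fin 3) ℝ := Matrix.of fun i => v (t i)

/-- The value at `x` of the linear functional that interpolates the heights `h` at the generators
indexed by `t`. -/
noncomputable def interp (h : Fin b → ℝ) (t : Fin 3 → Fin b) (x : Fin 3 → ℝ) : ℝ :=
  coord (coneMatrix v t) x ⬝ᵥ (h ∘ t)

/-- The cells of the regular subdivision with heights `h`. -/
structure IsCell (h : Fin b → ℝ) (t : Fin 3 → Fin b) : Prop where
  strictMono : StrictMono t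
  det_ne_zero : (coneMatrix v t).det ≠ 0
  interp_le : ∀ s, interp v h t (v s) ≤ h s

/-- No four points of the lifted configuration are in special position. -/
def IsGeneric (h : Fin b → ℝ) : Prop :=
  ∀ t, (coneMatrix v t).det ≠ 0 → ∀ s, s ∉ Set.range t → interp v h t (v s) ≠ h s

variable {v} {h : Fin b → ℝ}

theorem sum_coord_smul_cone {t : Fin 3 → Fin b} (ht : (coneMatrix v t).det ≠ 0) (x : Fin 3 → ℝ) :
    ∑ i, coord (coneMatrix v t) x i • v (t i) = x :=
  sum_coord_smul ht x

theorem coord_cone_self {t : Fin 3 → Fin b} (ht : (coneMatrix v t).det ≠ 0) (i : Fin 3) :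
    coord (coneMatrix v t) (v (t i)) = Pi.single i 1 :=
  coord_row ht i

theorem dotProduct_eq_coord {t : Fin 3 → Fin b} (ht : (coneMatrix v t).det ≠ 0)
    (x y : Fin 3 → ℝ) : x ⬝ᵥ y = ∑ i, coord (coneMatrix v t) x i * (v (t i) ⬝ᵥ y) := by
  conv_lhs => rw [← sum_coord_smul_cone ht x, sum_dotProduct]
  simp only [smul_dotProduct, smul_eq_mul]

theorem interp_sum (t : Fin 3 → Fin b) (c : Fin 3 → ℝ) (z : Fin 3 → Fin 3 → ℝ) :
    interp v h t (∑ i, c i • z i) = ∑ i, c i * interp v h t (z i) := by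
  simp only [Fin.sum_univ_three, interp, coord_add, coord_smul, add_dotProduct, smul_dotProduct,
    smul_eq_mul]

/-- On its own cone the interpolant of a cell dominates that of every other cell, because the latter
lies below the heights at the generators. -/
theorem interp_le_of_coord_nonneg {t t' : Fin 3 → Fin b} (ht : IsCell v h t)
    (ht' : IsCell v h t') {x : Fin 3 → ℝ} (hx : 0 ≤ coord (coneMatrix v t') x) :
    interp v h t x ≤ interp v h t' x := by
  conv_lhs => rw [← sum_coord_smul_cone ht'.det_ne_zero x]
  rw [interp_sum]
  exact Finset.sum_le_sum fun i _ => mul_le_mul_of_nonneg_left (ht.interp_le _) (hx i)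

/-- Distinct cells have disjoint interiors. -/
theorem IsCell.eq_of_coord_pos (hg : IsGeneric v h) {t t' : Fin 3 → Fin b} (ht : IsCell v h t)
    (ht' : IsCell v h t') {x : Fin 3 → ℝ} (hx : ∀ i, 0 < coord (coneMatrix v t) x i)
    (hx' : 0 ≤ coord (coneMatrix v t') x) : t = t' := by
  have h1 : interp v h t' x = interp v h t x :=
    le_antisymm (interp_le_of_coord_nonneg ht' ht fun i => (hx i).le)
      (interp_le_of_coord_nonneg ht ht' hx')
  have h2 : ∀ i, interp v h t' (v (t i)) = h (t i) := by
    have h3 : interp v h t' x = ∑ i, coord (coneMatrix v t) x i * interp v h t' (v (t i)) := by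
      conv_lhs => rw [← sum_coord_smul_cone ht.det_ne_zero x]
      rw [interp_sum]
    rw [h3] at h1
    have h4 := (Finset.sum_eq_sum_iff_of_le fun i _ =>
      mul_le_mul_of_nonneg_left (ht'.interp_le (t i)) (hx i).le).1 h1
    exact fun i => mul_left_cancel₀ (hx i).ne' (h4 i (Finset.mem_univ i))
  have h3 : Set.range t ⊆ Set.range t' := by
    rintro _ ⟨i, rfl⟩
    by_contra hi
    exact hg t' ht'.det_ne_zero _ hi (h2 i)
  have h4 : Set.range t = Set.range t' := by
    apply Set.eq_of_subset_of_ncard_le h3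
    rw [← Set.image_univ, ← Set.image_univ, Set.ncard_image_of_injective _ ht.strictMono.injective,
      Set.ncard_image_of_injective _ ht'.strictMono.injective]
  exact (StrictMono.range_inj ht.strictMono ht'.strictMono).1 h4

/-- The points `v` positively span the space. -/
def PositivelySpans (v : Fin b → Fin 3 → ℝ) : Prop :=
  ∃ r > 0, ∀ x : Fin 3 → ℝ, (∀ i, |x i| ≤ r) → ∀ y : Fin 3 → ℝ, ∃ s, x ⬝ᵥ y ≤ v s ⬝ᵥ y

/-- Positive spanning bounds each coordinate of `y`: test the condition on small multiples of the
signed unit vectors. The vertices of this dual polyhedron correspond to the cells. -/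
theorem isCompact_dual (hv : PositivelySpans v) (h : Fin b → ℝ) :
    IsCompact {y : Fin 3 → ℝ | ∀ s, v s ⬝ᵥ y ≤ h s} := by
  obtain ⟨r, hr, hv⟩ := hv
  apply Metric.isCompact_of_isClosed_isBounded
  · rw [Set.ofPred_forall]
    refine isClosed_iInter fun s => isClosed_le (by fun_prop) continuous_const
  · refine (Metric.isBounded_closedBall (x := (0 : Fin 3 → ℝ)) (r := (∑ s, |h s|) / r)).subset ?_
    intro y hy
    rw [mem_closedBall_zero_iff, pi_norm_le_iff_of_nonneg (by positivity)]
    intro i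
    rw [Real.norm_eq_abs, le_div_iff₀ hr]
    obtain ⟨ε, hε, he⟩ : ∃ ε : ℝ, |ε| = 1 ∧ ε * y i = |y i| := by
      rcases abs_cases (y i) with ⟨e, -⟩ | ⟨e, -⟩
      · exact ⟨1, by simp, by rw [e, one_mul]⟩
      · exact ⟨-1, by simp, by rw [e, neg_one_mul]⟩
    obtain ⟨s, hs⟩ := hv (Pi.single i (ε * r)) (by
      intro j
      rcases eq_or_ne j i with rfl | hj
      · rw [Pi.single_eq_same, abs_mul, hε, one_mul, abs_of_pos hr]
      · simp [Pi.single_eq_of_ne hj, hr.le]) y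
    rw [single_dotProduct] at hs
    calc |y i| * r = ε * r * y i := by rw [← he]; ring
      _ ≤ v s ⬝ᵥ y := hs
      _ ≤ h s := hy s
      _ ≤ |h s| := le_abs_self _
      _ ≤ _ := Finset.single_le_sum (f := fun s => |h s|) (fun _ _ => abs_nonneg _)
        (Finset.mem_univ s)

theorem eventually_mem_dual {y d : Fin 3 → ℝ} (hy : ∀ s, v s ⬝ᵥ y ≤ h s)
    (hd : ∀ s, v s ⬝ᵥ y = h s → v s ⬝ᵥ d ≤ 0) :
    ∀ᶠ ε : ℝ in 𝓝[>] 0, ∀ s, v s ⬝ᵥ (y + ε • d) ≤ h s := by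
  refine eventually_all.2 fun s => ?_
  simp only [dotProduct_add, dotProduct_smul, smul_eq_mul]
  rcases (hy s).eq_or_lt with hs | hs
  · filter_upwards [self_mem_nhdsWithin] with ε hε
    rw [hs]
    linarith [mul_nonpos_of_nonneg_of_nonpos (le_of_lt hε) (hd s hs)]
  · have hc : Continuous fun ε : ℝ => v s ⬝ᵥ y + ε * (v s ⬝ᵥ d) := by fun_prop
    have : Tendsto (fun ε : ℝ => v s ⬝ᵥ y + ε * (v s ⬝ᵥ d)) (𝓝[>] 0) (𝓝 (v s ⬝ᵥ y)) := by
      simpa using (hc.tendsto 0).mono_left nhdsWithin_le_nhds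
    filter_upwards [this.eventually (gt_mem_nhds hs)] with ε hε using le_of_lt hε

/-- The maximum of a linear functional over the dual polyhedron is attained at a point where the
active constraints span. -/
theorem exists_vertex_dual (hv : PositivelySpans v) (hh : ∀ s, 0 < h s) (x : Fin 3 → ℝ) :
    ∃ y : Fin 3 → ℝ, (∀ s, v s ⬝ᵥ y ≤ h s) ∧
      (∀ y' : Fin 3 → ℝ, (∀ s, v s ⬝ᵥ y' ≤ h s) → x ⬝ᵥ y' ≤ x ⬝ᵥ y) ∧
      Submodule.span ℝ (Set.range fun s : {s // v s ⬝ᵥ y = h s} => v s) = ⊤ := by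
  have hQ := isCompact_dual hv h
  have hcont : Continuous fun y : Fin 3 → ℝ => x ⬝ᵥ y := by
    simp only [dotProduct]; fun_prop
  obtain ⟨y₀, hy₀, hmax⟩ := hQ.exists_isMaxOn ⟨0, fun s => by simpa using (hh s).le⟩
    hcont.continuousOn
  have hF : IsCompact ({y : Fin 3 → ℝ | ∀ s, v s ⬝ᵥ y ≤ h s} ∩ {y | x ⬝ᵥ y = x ⬝ᵥ y₀}) :=
    hQ.inter_right (isClosed_eq hcont continuous_const)
  obtain ⟨y, hy⟩ := hF.extremePoints_nonempty ⟨y₀, hy₀, rfl⟩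
  obtain ⟨⟨hyQ, hyx⟩, hext⟩ := mem_extremePoints.1 hy
  refine ⟨y, hyQ, fun y' hy' => ?_, ?_⟩
  · rw [hyx]
    exact hmax hy'
  by_contra hspan
  obtain ⟨f, hf0, hf⟩ := Submodule.exists_le_ker_of_lt_top _ (lt_top_iff_ne_top.2 hspan)
  -- If the active constraints do not span, some nonzero `d` is orthogonal to all of them. Small
  -- moves along `d` and `-d` stay in the optimal face, contradicting extremality of `y`.
  set d : Fin 3 → ℝ := fun i => f (Pi.single i 1) with hd
  have hfd : ∀ z, f z = z ⬝ᵥ d := fun z => by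
    rw [LinearMap.pi_apply_eq_sum_univ f z]
    simp only [dotProduct, hd, smul_eq_mul]
    refine Finset.sum_congr rfl fun i _ => ?_
    congr 2
    ext j
    simp [Pi.single_apply, eq_comm]
  have hact : ∀ s, v s ⬝ᵥ y = h s → v s ⬝ᵥ d = 0 := fun s hs => by
    rw [← hfd]
    exact hf (Submodule.subset_span ⟨⟨s, hs⟩, rfl⟩)
  obtain ⟨ε, ⟨h1, h2⟩, hε⟩ := (((eventually_mem_dual hyQ fun s hs => (hact s hs).le).and
    (eventually_mem_dual (d := -d) hyQ fun s hs => by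
      rw [dotProduct_neg, hact s hs, neg_zero])).and self_mem_nhdsWithin).exists
  have hε : 0 < ε := hε
  have m1 : x ⬝ᵥ (y + ε • d) ≤ x ⬝ᵥ y₀ := hmax h1
  have m2 : x ⬝ᵥ (y + ε • -d) ≤ x ⬝ᵥ y₀ := hmax h2
  simp only [dotProduct_add, dotProduct_smul, dotProduct_neg, smul_eq_mul] at m1 m2
  have hyx' : x ⬝ᵥ y = x ⬝ᵥ y₀ := hyx
  have e1 : y + ε • d = y := by
    refine (hext _ ⟨h1, ?_⟩ _ ⟨h2, ?_⟩ ?_).1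
    · simp only [Set.mem_ofPred_eq, dotProduct_add, dotProduct_smul, smul_eq_mul]
      linarith
    · simp only [Set.mem_ofPred_eq, dotProduct_add, dotProduct_smul, dotProduct_neg, smul_eq_mul]
      linarith
    · refine ⟨1 / 2, 1 / 2, by norm_num, by norm_num, by norm_num, ?_⟩
      ext i
      simp only [Pi.add_apply, Pi.smul_apply, Pi.neg_apply, smul_eq_mul]
      ring
  have hd0 : d = 0 := by
    have : ε • d = 0 := by simpa using e1
    exact (smul_eq_zero.1 this).resolve_left hε.ne'
  exact hf0 (LinearMap.ext fun z => by rw [hfd, hd0, dotProduct_zero]; rfl)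

theorem exists_strictMono_det_ne_zero {p : Fin b → Prop}
    (hp : Submodule.span ℝ (Set.range fun s : {s // p s} => v s) = ⊤) :
    ∃ t : Fin 3 → Fin b, StrictMono t ∧ (∀ i, p (t i)) ∧ (coneMatrix v t).det ≠ 0 := by
  obtain ⟨κ, a, ha, hspan, hli⟩ := exists_linearIndependent' ℝ (fun s : {s // p s} => v s)
  rw [hp] at hspan
  have : Finite κ := Finite.of_injective a ha
  have : Fintype κ := Fintype.ofFinite κ
  have hcard : Fintype.card κ = 3 := by
    have := Module.finrank_eq_card_basis (Module.Basis.mk hli hspan.ge)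
    simpa using this.symm
  let e : Fin 3 ≃ κ := (finCongr hcard.symm).trans (Fintype.equivFin κ).symm
  let u : Fin 3 → Fin b := fun i => a (e i)
  have hu : Function.Injective u := Subtype.val_injective.comp (ha.comp e.injective)
  refine ⟨u ∘ Tuple.sort u, (Tuple.monotone_sort u).strictMono_of_injective
    (hu.comp (Equiv.injective _)), fun i => (a (e _)).2, ?_⟩
  have hli' : LinearIndependent ℝ (coneMatrix v (u ∘ Tuple.sort u)).row :=
    hli.comp (e ∘ Tuple.sort u) (e.injective.comp (Equiv.injective _))
  rw [linearIndependent_rows_iff_isUnit, isUnit_iff_isUnit_det] at hli'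
  exact hli'.ne_zero

/-- The cells cover the space. -/
theorem exists_cell_coord_nonneg (hv : PositivelySpans v) (hh : ∀ s, 0 < h s)
    (hg : IsGeneric v h) (x : Fin 3 → ℝ) :
    ∃ t, IsCell v h t ∧ 0 ≤ coord (coneMatrix v t) x := by
  obtain ⟨y, hyQ, hmax, hspan⟩ := exists_vertex_dual hv hh x
  obtain ⟨t, hmono, hact, hdet⟩ := exists_strictMono_det_ne_zero hspan
  have hint : ∀ z, interp v h t z = z ⬝ᵥ y := fun z => by
    rw [dotProduct_eq_coord hdet z y]
    simp only [hact]
    rfl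
  refine ⟨t, ⟨hmono, hdet, fun s => by rw [hint]; exact hyQ s⟩, fun i => ?_⟩
  by_contra hi
  rw [Pi.zero_apply, not_le] at hi
  -- The edge of the dual polyhedron that relaxes only constraint `i`. By genericity no constraint
  -- outside `t` is active, so it is feasible, and a negative coordinate of `x` would increase the
  -- maximum.
  set d := (coneMatrix v t)⁻¹ *ᵥ (-Pi.single i 1) with hd
  have hvd : ∀ j, v (t j) ⬝ᵥ d = -(Pi.single i 1 : Fin 3 → ℝ) j := fun j => by
    have : coneMatrix v t *ᵥ d = -Pi.single i 1 := by
      rw [hd, mulVec_mulVec, mul_nonsing_inv _ (isUnit_iff_ne_zero.2 hdet), one_mulVec]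
    exact congrFun this j
  obtain ⟨ε, h1, hε⟩ := ((eventually_mem_dual (d := d) hyQ fun s hs => by
    by_cases hst : s ∈ Set.range t
    · obtain ⟨j, rfl⟩ := hst
      rw [hvd, neg_nonpos, Pi.single_apply]
      split_ifs <;> norm_num
    · exact absurd ((hint _).trans hs) (hg t hdet s hst)).and self_mem_nhdsWithin).exists
  have hε : 0 < ε := hε
  have h2 := hmax _ h1
  rw [dotProduct_add, dotProduct_smul, dotProduct_eq_coord hdet x d] at h2
  simp only [hvd, mul_neg, Finset.sum_neg_distrib, Pi.single_apply, mul_ite, mul_one, mul_zero,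
    Finset.sum_ite_eq', Finset.mem_univ, if_true, smul_eq_mul] at h2
  have := mul_neg_of_pos_of_neg hε hi
  linarith

/-- The points `v` are in weakly convex position around the origin. -/
def OnBoundary (v : Fin b → Fin 3 → ℝ) : Prop :=
  ∀ s (w : Fin 3 → Fin b) (c : Fin 3 → ℝ), 0 ≤ c → ∑ i, c i • v (w i) = v s → 1 ≤ ∑ i, c i

/-- There are generic heights for which each cell lies over a triangle in the boundary of the
convex hull that contains no points of the configuration but its vertices. -/
theorem exists_heights (hinj : Function.Injective v) (hb : OnBoundary v) :
    ∃ h : Fin b → ℝ, (∀ s, 0 < h s) ∧ IsGeneric v h ∧ ∀ t, IsCell v h t →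
      (∀ s, ∑ i, coord (coneMatrix v t) (v s) i ≤ 1) ∧
      ∀ s, 0 ≤ coord (coneMatrix v t) (v s) → s ∈ Set.range t := by
  let good : (Fin 3 → Fin b) → Prop := fun t =>
    (∀ s, ∑ i, coord (coneMatrix v t) (v s) i ≤ 1) ∧
      ∀ s, 0 ≤ coord (coneMatrix v t) (v s) → s ∈ Set.range t
  -- Positive heights for which no bad triple is a cell: an open condition, so it leaves room for a
  -- generic choice.
  let U : Set (Fin b → ℝ) := {h | (∀ s, 0 < h s) ∧
    ∀ t, (coneMatrix v t).det ≠ 0 → ¬ good t → ∃ s, h s < interp v h t (v s)}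
  have hcont : ∀ t x, Continuous fun h : Fin b → ℝ => interp v h t x := fun t x => by
    simp only [interp, dotProduct, Function.comp]
    fun_prop
  have hU : IsOpen U := by
    simp only [U, Set.ofPred_and, Set.ofPred_forall, Set.ofPred_exists]
    refine (isOpen_iInter_of_finite fun s => isOpen_lt continuous_const (by fun_prop)).inter
      (isOpen_iInter_of_finite fun t => isOpen_iInter_of_finite fun _ =>
        isOpen_iInter_of_finite fun _ => isOpen_iUnion fun s => isOpen_lt (by fun_prop) (hcont t _))
  have hne : U.Nonempty := by
    suffices H : ∀ᶠ τ : ℝ in 𝓝[>] 0, (fun s => 1 + τ * (v s ⬝ᵥ v s)) ∈ U from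
      H.exists.elim fun τ hτ => ⟨_, hτ⟩
    have hc : Continuous fun τ : ℝ => fun s => 1 + τ * (v s ⬝ᵥ v s) := by fun_prop
    refine Filter.Eventually.and ?_ (eventually_all.2 fun t => ?_)
    · filter_upwards [self_mem_nhdsWithin] with τ hτ s
      have : 0 ≤ τ * (v s ⬝ᵥ v s) :=
        mul_nonneg (le_of_lt hτ) (Finset.sum_nonneg fun i _ => mul_self_nonneg _)
      linarith
    by_cases hdet : (coneMatrix v t).det = 0
    · simp [hdet]
    by_cases hsum : ∀ s, ∑ i, coord (coneMatrix v t) (v s) i ≤ 1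
    · by_cases hemp : ∀ s, 0 ≤ coord (coneMatrix v t) (v s) → s ∈ Set.range t
      · exact Eventually.of_forall fun τ _ hn => absurd ⟨hsum, hemp⟩ hn
      push Not at hemp
      obtain ⟨s, hs, hst⟩ := hemp
      filter_upwards [self_mem_nhdsWithin] with τ hτ _ _
      have hτ : 0 < τ := hτ
      refine ⟨s, ?_⟩
      set c := coord (coneMatrix v t) (v s) with hc
      have e : ∑ i, c i • v (t i) = v s := sum_coord_smul_cone hdet _
      have h1 : ∑ i, c i = 1 := le_antisymm (hsum s) (hb s t c hs e)
      -- Here `v s` is a convex combination of the generators. Strict convexity of the squared norm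
      -- puts the interpolant above the height at `s`.
      have h2 : 0 < ∑ i, c i * ((v (t i) - v s) ⬝ᵥ (v (t i) - v s)) := by
        obtain ⟨j, -, hj⟩ := Finset.exists_ne_zero_of_sum_ne_zero (h1.trans_ne one_ne_zero)
        refine Finset.sum_pos' (fun i _ => mul_nonneg (hs i)
          (Finset.sum_nonneg fun i _ => mul_self_nonneg _)) ⟨j, Finset.mem_univ j, ?_⟩
        refine mul_pos (lt_of_le_of_ne (hs j) hj.symm) (lt_of_le_of_ne
          (Finset.sum_nonneg fun i _ => mul_self_nonneg _) fun h0 => ?_)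
        have := dotProduct_self_eq_zero.1 h0.symm
        exact hst ⟨j, hinj (sub_eq_zero.1 this)⟩
      have h3 : ∑ i, c i * ((v (t i) - v s) ⬝ᵥ (v (t i) - v s))
          = ∑ i, c i * (v (t i) ⬝ᵥ v (t i)) - v s ⬝ᵥ v s := by
        have h4 : ∑ i, c i * (v (t i) ⬝ᵥ v s) = v s ⬝ᵥ v s := (dotProduct_eq_coord hdet _ _).symm
        calc _ = ∑ i, (c i * (v (t i) ⬝ᵥ v (t i)) - 2 * (c i * (v (t i) ⬝ᵥ v s))
              + c i * (v s ⬝ᵥ v s)) := by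
              refine Finset.sum_congr rfl fun i _ => ?_
              rw [sub_dotProduct, dotProduct_sub, dotProduct_sub, dotProduct_comm (v s) (v (t i))]
              ring
          _ = _ := by
              rw [Finset.sum_add_distrib, Finset.sum_sub_distrib, ← Finset.mul_sum, h4,
                ← Finset.sum_mul, h1]
              ring
      have h5 : interp v (fun s => 1 + τ * (v s ⬝ᵥ v s)) t (v s)
          = 1 + τ * ∑ i, c i * (v (t i) ⬝ᵥ v (t i)) := by
        calc interp v (fun s => 1 + τ * (v s ⬝ᵥ v s)) t (v s)
            = ∑ i, c i * (1 + τ * (v (t i) ⬝ᵥ v (t i))) := rfl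
          _ = ∑ i, (c i + τ * (c i * (v (t i) ⬝ᵥ v (t i)))) :=
              Finset.sum_congr rfl fun i _ => by ring
          _ = _ := by rw [Finset.sum_add_distrib, h1, Finset.mul_sum]
      change 1 + τ * (v s ⬝ᵥ v s) < _
      rw [h5]
      rw [h3] at h2
      have := mul_pos hτ h2
      linarith
    · push Not at hsum
      obtain ⟨s, hs⟩ := hsum
      -- At τ = 0 all heights are 1 and the interpolant at `v s` is the coordinate sum, which
      -- exceeds 1; this persists for small τ.
      have l1 : Tendsto (fun τ : ℝ => interp v (fun s => 1 + τ * (v s ⬝ᵥ v s)) t (v s)) (𝓝[>] 0)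
          (𝓝 (∑ i, coord (coneMatrix v t) (v s) i)) := by
        have := (((hcont t (v s)).comp hc).tendsto 0).mono_left (nhdsWithin_le_nhds (s := Set.Ioi 0))
        simpa [interp, dotProduct, Function.comp_def] using this
      have l2 : Tendsto (fun τ : ℝ => 1 + τ * (v s ⬝ᵥ v s)) (𝓝[>] 0) (𝓝 1) := by
        have := (((continuous_apply s).comp hc).tendsto 0).mono_left
          (nhdsWithin_le_nhds (s := Set.Ioi 0))
        simpa [Function.comp_def] using this
      filter_upwards [l2.eventually_lt l1 hs] with τ hτ _ _ using ⟨s, hτ⟩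
  let φ : {p : (Fin 3 → Fin b) × Fin b // (coneMatrix v p.1).det ≠ 0 ∧ p.2 ∉ Set.range p.1} →
      (Fin b → ℝ) →ₗ[ℝ] ℝ := fun p =>
    { toFun := fun h => interp v h p.1.1 (v p.1.2) - h p.1.2
      map_add' := fun g h => by
        simp only [interp, Pi.add_comp, dotProduct_add, Pi.add_apply]
        ring
      map_smul' := fun r h => by
        simp only [interp, Pi.smul_comp, dotProduct_smul, Pi.smul_apply, smul_eq_mul,
          RingHom.id_apply]
        ring }
  have hφ : ∀ p, φ p ≠ 0 := by
    rintro ⟨⟨t, s⟩, hdet, hst⟩ h0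
    have h1 := LinearMap.congr_fun h0 (Pi.single s 1)
    have h2 : (Pi.single s 1 : Fin b → ℝ) ∘ t = 0 := by
      ext i
      exact Pi.single_eq_of_ne (fun e => hst ⟨i, e⟩) _
    simp [φ, interp, h2] at h1
  obtain ⟨h, ⟨hpos, hcell⟩, hgen⟩ := exists_mem_forall_functional_ne_zero φ hφ hU hne
  refine ⟨h, hpos, fun t ht s hs => sub_ne_zero.1 (hgen ⟨(t, s), ht, hs⟩), fun t ht => ?_⟩
  by_contra hbad
  obtain ⟨s, hs⟩ := hcell t ht.det_ne_zero hbad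
  exact absurd (ht.interp_le s) (not_le.2 hs)

end Fan

/-! ### Counting the cones -/

section Count

variable {b : ℕ} {v : Fin b → Fin 3 → ℝ} {h : Fin b → ℝ}

open Classical in
/-- The finite set of cells. -/
noncomputable def cells (v : Fin b → Fin 3 → ℝ) (h : Fin b → ℝ) : Finset (Fin 3 → Fin b) :=
  Finset.univ.filter fun t => IsCell v h t

theorem mem_cells {t : Fin 3 → Fin b} : t ∈ cells v h ↔ IsCell v h t := by
  simp [cells]

/-- The negative coordinates of `w` in the cone indexed by `t`. -/
noncomputable def negCoords (v : Fin b → Fin 3 → ℝ) (w : Fin 3 → ℝ) (t : Fin 3 → Fin b) :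
    Finset (Fin 3) :=
  Finset.univ.filter fun i => coord (coneMatrix v t) w i < 0

theorem exists_forall_coord_ne_zero (v : Fin b → Fin 3 → ℝ) : ∃ w : Fin 3 → ℝ,
    ∀ t, (coneMatrix v t).det ≠ 0 → ∀ i, coord (coneMatrix v t) w i ≠ 0 := by
  let φ : {t : Fin 3 → Fin b // (coneMatrix v t).det ≠ 0} × Fin 3 → (Fin 3 → ℝ) →ₗ[ℝ] ℝ :=
    fun p =>
    { toFun := fun w => coord (coneMatrix v p.1) w p.2
      map_add' := fun x y => by rw [coord_add]; rfl
      map_smul' := fun r x => by rw [coord_smul]; rfl }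
  have hφ : ∀ p, φ p ≠ 0 := by
    rintro ⟨⟨t, ht⟩, i⟩ h0
    have := LinearMap.congr_fun h0 (v (t i))
    simp [φ, coord_cone_self ht] at this
  obtain ⟨w, -, hw⟩ := exists_mem_forall_functional_ne_zero φ hφ isOpen_univ Set.univ_nonempty
  exact ⟨w, fun t ht i => hw ⟨⟨t, ht⟩, i⟩⟩

/-- Each generator lies in a cell in which all other coordinates of `w` are positive. -/
theorem exists_cell_coord_pos (hv : PositivelySpans v) (hh : ∀ s, 0 < h s) (hg : IsGeneric v h)
    (hemp : ∀ t, IsCell v h t → ∀ s, 0 ≤ coord (coneMatrix v t) (v s) → s ∈ Set.range t)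
    {w : Fin 3 → ℝ}
    (hw : ∀ t, (coneMatrix v t).det ≠ 0 → ∀ i, coord (coneMatrix v t) w i ≠ 0) (s : Fin b) :
    ∃ t, IsCell v h t ∧ ∃ i, t i = s ∧ ∀ j, j ≠ i → 0 < coord (coneMatrix v t) w j := by
  obtain ⟨⟨t, ht⟩, h1, h2⟩ := exists_cone_along
    (fun t : {t // IsCell v h t} => coneMatrix v t.1) (v s) w
    (Eventually.of_forall fun ε => by
      obtain ⟨t, ht, h1⟩ := exists_cell_coord_nonneg hv hh hg (v s + ε • w)
      exact ⟨⟨t, ht⟩, h1⟩)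
  obtain ⟨i, rfl⟩ := hemp t ht s h1
  refine ⟨t, ht, i, rfl, fun j hj => lt_of_le_of_ne (h2 j ?_) (hw t ht.det_ne_zero j).symm⟩
  rw [coord_cone_self ht.det_ne_zero, Pi.single_eq_of_ne hj]

/-- Assign to each generator the cell entered from it in direction `w`. A cell with one negative
coordinate receives at most the generator at that coordinate. A cell with none receives at most
three, and only the cell around `w` is of this kind, hence the excess 2. -/
theorem le_card_cells_filter_add_two (hv : PositivelySpans v) (hh : ∀ s, 0 < h s)
    (hg : IsGeneric v h)
    (hemp : ∀ t, IsCell v h t → ∀ s, 0 ≤ coord (coneMatrix v t) (v s) → s ∈ Set.range t)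
    {w : Fin 3 → ℝ}
    (hw : ∀ t, (coneMatrix v t).det ≠ 0 → ∀ i, coord (coneMatrix v t) w i ≠ 0) :
    b ≤ ((cells v h).filter fun t => (negCoords v w t).card ≤ 1).card + 2 := by
  choose T hT i hi hpos using exists_cell_coord_pos hv hh hg hemp hw
  set S := (cells v h).filter fun t => (negCoords v w t).card ≤ 1 with hS
  have hneg : ∀ s, negCoords v w (T s) ⊆ {i s} := fun s j hj => by
    rw [Finset.mem_singleton]
    by_contra hne
    exact absurd (Finset.mem_filter.1 hj).2 (hpos s j hne).not_gt
  have hmem : ∀ s ∈ (Finset.univ : Finset (Fin b)), T s ∈ S := fun s _ =>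
    Finset.mem_filter.2 ⟨mem_cells.2 (hT s), (Finset.card_le_card (hneg s)).trans_eq (by simp)⟩
  have hfib : ∀ t ∈ S, (Finset.univ.filter fun s => T s = t).card
      ≤ 1 + if negCoords v w t = ∅ then 2 else 0 := by
    intro t ht
    split_ifs with h0
    · calc _ ≤ (Finset.univ.image t).card := Finset.card_le_card fun s hs => by
            obtain rfl := (Finset.mem_filter.1 hs).2
            exact Finset.mem_image.2 ⟨i s, Finset.mem_univ _, hi s⟩
        _ ≤ 3 := Finset.card_image_le.trans (by simp)
    · obtain ⟨j, hj⟩ := Finset.nonempty_iff_ne_empty.2 h0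
      refine Finset.card_le_one.2 fun s hs s' hs' => ?_
      have key : ∀ s, T s = t → s = t j := by
        rintro s rfl
        have := hneg s hj
        rw [Finset.mem_singleton] at this
        rw [this, hi]
      rw [key s (Finset.mem_filter.1 hs).2, key s' (Finset.mem_filter.1 hs').2]
  have hone : (S.filter fun t => negCoords v w t = ∅).card ≤ 1 := by
    refine Finset.card_le_one.2 fun t ht t' ht' => ?_
    have key : ∀ t ∈ S.filter fun t => negCoords v w t = ∅,
        IsCell v h t ∧ ∀ i, 0 < coord (coneMatrix v t) w i := by
      intro t ht
      rw [Finset.mem_filter, hS, Finset.mem_filter, mem_cells] at ht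
      refine ⟨ht.1.1, fun i => lt_of_le_of_ne ?_ (hw t ht.1.1.det_ne_zero i).symm⟩
      by_contra hi
      have : i ∈ negCoords v w t := Finset.mem_filter.2 ⟨Finset.mem_univ i, not_le.1 hi⟩
      simp [ht.2] at this
    exact (key t ht).1.eq_of_coord_pos hg (key t' ht').1 (key t ht).2
      fun i => ((key t' ht').2 i).le
  calc b = (Finset.univ : Finset (Fin b)).card := by simp
    _ = ∑ t ∈ S, (Finset.univ.filter fun s => T s = t).card :=
        Finset.card_eq_sum_card_fiberwise hmem
    _ ≤ ∑ t ∈ S, (1 + if negCoords v w t = ∅ then 2 else 0) := Finset.sum_le_sum hfib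
    _ = S.card + 2 * (S.filter fun t => negCoords v w t = ∅).card := by
        rw [Finset.sum_add_distrib, ← Finset.sum_filter, Finset.sum_const, Finset.sum_const]
        simp [mul_comm]
    _ ≤ S.card + 2 := by omega

/-- The inequality half of Euler's formula for the complete simplicial fan. -/
theorem two_mul_le_card_cells (hv : PositivelySpans v) (hh : ∀ s, 0 < h s)
    (hg : IsGeneric v h)
    (hemp : ∀ t, IsCell v h t → ∀ s, 0 ≤ coord (coneMatrix v t) (v s) → s ∈ Set.range t) :
    2 * b ≤ (cells v h).card + 4 := by
  obtain ⟨w, hw⟩ := exists_forall_coord_ne_zero v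
  have h1 := le_card_cells_filter_add_two hv hh hg hemp hw
  have h2 := le_card_cells_filter_add_two hv hh hg hemp (w := -w) fun t ht i => by
    rw [coord_neg]
    exact neg_ne_zero.2 (hw t ht i)
  -- Three nonzero coordinates cannot include at most one negative and at most one positive, so the
  -- counts for `w` and `-w` add.
  have h3 : Disjoint ((cells v h).filter fun t => (negCoords v w t).card ≤ 1)
      ((cells v h).filter fun t => (negCoords v (-w) t).card ≤ 1) := by
    refine Finset.disjoint_left.2 fun t ht ht' => ?_
    rw [Finset.mem_filter, mem_cells] at ht ht'
    have h4 : negCoords v w t ∪ negCoords v (-w) t = Finset.univ := by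
      ext i
      simp only [negCoords, coord_neg, Finset.mem_union, Finset.mem_filter, Finset.mem_univ,
        true_and, Pi.neg_apply, neg_lt_zero, iff_true]
      exact (hw t ht.1.det_ne_zero i).lt_or_gt
    have h5 := Finset.card_union_le (negCoords v w t) (negCoords v (-w) t)
    rw [h4, Finset.card_univ, Fintype.card_fin] at h5
    omega
  have h6 := Finset.card_le_card (Finset.union_subset
    (Finset.filter_subset (fun t => (negCoords v w t).card ≤ 1) (cells v h))
    (Finset.filter_subset (fun t => (negCoords v (-w) t).card ≤ 1) (cells v h)))
  rw [Finset.card_union_of_disjoint h3] at h6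
  omega

end Count

/-! ### Volumes of the pyramids -/

/-- The corner simplex spanned by the origin and the unit vectors. -/
def cornerSimplex : Set (Fin 3 → ℝ) := {c | 0 ≤ c ∧ ∑ i, c i ≤ 1}

theorem isClosed_cornerSimplex : IsClosed cornerSimplex :=
  (isClosed_Ici (a := (0 : Fin 3 → ℝ))).inter
    (isClosed_le (f := fun c : Fin 3 → ℝ => ∑ i, c i) (by fun_prop) continuous_const)

/-- The cube is covered by six copies of the simplex of increasing triples, which has the same
volume as the corner simplex. -/
theorem one_le_six_mul_volume_cornerSimplex : 1 ≤ 6 * volume cornerSimplex := by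
  -- Successive differences: the preimage of the corner simplex is 0 ≤ y₀ ≤ y₁ ≤ y₂ ≤ 1.
  let f : (Fin 3 → ℝ) →ₗ[ℝ] (Fin 3 → ℝ) := Matrix.toLin' !![1, 0, 0; -1, 1, 0; 0, -1, 1]
  have hf : LinearMap.det f = 1 := by
    simp [f, LinearMap.det_toLin', Matrix.det_fin_three]
  have hO : volume (f ⁻¹' cornerSimplex) = volume cornerSimplex := by
    rw [Measure.addHaar_preimage_linearMap _ (by rw [hf]; exact one_ne_zero), hf]
    simp
  have hperm : ∀ σ : Equiv.Perm (Fin 3),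
      volume ((fun y : Fin 3 → ℝ => y ∘ σ) ⁻¹' (f ⁻¹' cornerSimplex)) = volume cornerSimplex := by
    intro σ
    have he : (fun y : Fin 3 → ℝ => y ∘ σ)
        = MeasurableEquiv.piCongrLeft (fun _ : Fin 3 => ℝ) σ.symm := by
      ext y i
      simp [MeasurableEquiv.coe_piCongrLeft, Equiv.piCongrLeft_apply]
    rw [← hO, he, (volume_measurePreserving_piCongrLeft (fun _ : Fin 3 => ℝ)
      σ.symm).measure_preimage_equiv]
  have hcover : Set.Icc (0 : Fin 3 → ℝ) 1 ⊆
      ⋃ σ : Equiv.Perm (Fin 3), (fun y : Fin 3 → ℝ => y ∘ σ) ⁻¹' (f ⁻¹' cornerSimplex) := by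
    intro y hy
    refine Set.mem_iUnion.2 ⟨Tuple.sort y, ?_⟩
    have hm := Tuple.monotone_sort y
    have h01 := hm (show (0 : Fin 3) ≤ 1 by decide)
    have h12 := hm (show (1 : Fin 3) ≤ 2 by decide)
    have h0 := hy.1 (Tuple.sort y 0)
    have h2 := hy.2 (Tuple.sort y 2)
    simp only [Function.comp, Pi.zero_apply, Pi.one_apply] at h01 h12 h0 h2
    refine ⟨fun i => ?_, ?_⟩
    · fin_cases i <;> simp [f, Matrix.mulVec, dotProduct, Fin.sum_univ_three] <;> linarith
    · simp [f, Matrix.mulVec, dotProduct, Fin.sum_univ_three]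
      linarith
  calc (1 : ENNReal) = volume (Set.Icc (0 : Fin 3 → ℝ) 1) := by simp [Real.volume_Icc_pi]
    _ ≤ ∑ σ : Equiv.Perm (Fin 3),
        volume ((fun y : Fin 3 → ℝ => y ∘ σ) ⁻¹' (f ⁻¹' cornerSimplex)) :=
      (measure_mono hcover).trans (measure_iUnion_fintype_le _ _)
    _ = 6 * volume cornerSimplex := by
      simp only [hperm, Finset.sum_const, Finset.card_univ, Fintype.card_perm, Fintype.card_fin,
        nsmul_eq_mul]
      norm_num [Nat.factorial]

theorem ofReal_abs_det_le_volume {M : Matrix (Fin 3) (Fin 3) ℝ} (hM : M.det ≠ 0) :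
    ENNReal.ofReal |M.det| ≤ 6 * volume (coord M ⁻¹' cornerSimplex) := by
  have hdet : LinearMap.det (M⁻¹).vecMulLinear = M.det⁻¹ := by
    rw [← Ring.inverse_eq_inv', ← det_nonsing_inv, ← det_transpose M⁻¹, ← LinearMap.det_toLin']
    congr 1
    ext x : 2
    simp
  have h1 := Measure.addHaar_preimage_linearMap volume (f := (M⁻¹).vecMulLinear)
    (by rw [hdet]; exact inv_ne_zero hM) cornerSimplex
  rw [hdet, inv_inv] at h1
  change volume (coord M ⁻¹' cornerSimplex) = _ at h1
  rw [h1, mul_left_comm]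
  exact le_mul_of_one_le_right' one_le_six_mul_volume_cornerSimplex

theorem continuous_coord (M : Matrix (Fin 3) (Fin 3) ℝ) : Continuous (coord M) :=
  (M⁻¹).vecMulLinear.continuous_of_finiteDimensional

section Volume

variable {b : ℕ} {v : Fin b → Fin 3 → ℝ} {h : Fin b → ℝ}

/-- A common point has a vanishing coordinate in `t`, so the overlap lies in three planes. -/
theorem aedisjoint_cells (hg : IsGeneric v h) {t t' : Fin 3 → Fin b} (ht : IsCell v h t)
    (ht' : IsCell v h t') (hne : t ≠ t') :
    AEDisjoint volume (coord (coneMatrix v t) ⁻¹' cornerSimplex)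
      (coord (coneMatrix v t') ⁻¹' cornerSimplex) := by
  let φ : Fin 3 → (Fin 3 → ℝ) →ₗ[ℝ] ℝ := fun i =>
    (LinearMap.proj i).comp (coneMatrix v t)⁻¹.vecMulLinear
  have hφ : ∀ i, LinearMap.ker (φ i) ≠ ⊤ := fun i hi => by
    rw [LinearMap.ker_eq_top] at hi
    have h1 : coord (coneMatrix v t) (v (t i)) i = 0 := LinearMap.congr_fun hi (v (t i))
    simp [coord_cone_self ht.det_ne_zero] at h1
  refine measure_mono_null (t := ⋃ i, ((LinearMap.ker (φ i) : Submodule ℝ (Fin 3 → ℝ)) :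
    Set (Fin 3 → ℝ))) (fun x hx => ?_) (measure_iUnion_null fun i =>
      Measure.addHaar_submodule _ _ (hφ i))
  by_contra hx'
  rw [Set.mem_iUnion, not_exists] at hx'
  exact hne (ht.eq_of_coord_pos hg ht' (fun i => lt_of_le_of_ne (hx.1.1 i) (Ne.symm (hx' i)))
    hx.2.1)

/-- The total volume of the tetrahedra over the cells is at most that of a convex set that
contains their vertices. -/
theorem sum_abs_det_cells_le (hg : IsGeneric v h) {P : Set (Fin 3 → ℝ)} (hP : Convex ℝ P)
    (h0 : 0 ∈ P) (hvP : ∀ s, v s ∈ P) (hfin : volume P ≠ ⊤) :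
    ∑ t ∈ cells v h, |(coneMatrix v t).det| ≤ 6 * (volume P).toReal := by
  have hsub : ∀ t ∈ cells v h, coord (coneMatrix v t) ⁻¹' cornerSimplex ⊆ P := by
    intro t ht x hx
    rw [← sum_coord_smul_cone (mem_cells.1 ht).det_ne_zero x]
    have h1 := hP.sum_mem (t := Finset.univ)
      (w := vecCons (1 - ∑ i, coord (coneMatrix v t) x i) (coord (coneMatrix v t) x))
      (z := vecCons 0 fun i => v (t i))
      (fun i _ => Fin.cases (sub_nonneg.2 hx.2) hx.1 i) (by simp [Fin.sum_univ_succ])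
      (fun i _ => Fin.cases h0 (fun i => hvP _) i)
    rw [Fin.sum_univ_succ] at h1
    simpa using h1
  have h1 : ∑ t ∈ cells v h, ENNReal.ofReal |(coneMatrix v t).det| ≤ 6 * volume P := by
    calc _ ≤ ∑ t ∈ cells v h, 6 * volume (coord (coneMatrix v t) ⁻¹' cornerSimplex) :=
          Finset.sum_le_sum fun t ht => ofReal_abs_det_le_volume (mem_cells.1 ht).det_ne_zero
      _ = 6 * volume (⋃ t ∈ cells v h, coord (coneMatrix v t) ⁻¹' cornerSimplex) := by
          rw [← Finset.mul_sum, measure_biUnion_finset₀]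
          · intro t ht t' ht' hne
            exact aedisjoint_cells hg (mem_cells.1 ht) (mem_cells.1 ht') hne
          · intro t _
            exact (isClosed_cornerSimplex.preimage
              (continuous_coord _)).measurableSet.nullMeasurableSet
      _ ≤ 6 * volume P := by
          gcongr
          exact Set.iUnion₂_subset hsub
  rw [← ENNReal.ofReal_sum_of_nonneg fun _ _ => abs_nonneg _] at h1
  have h2 := ENNReal.toReal_mono (ENNReal.mul_ne_top (by norm_num) hfin) h1
  rwa [ENNReal.toReal_ofReal (Finset.sum_nonneg fun _ _ => abs_nonneg _), ENNReal.toReal_mul]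
    at h2

end Volume

/-! ### Lattice polytopes and their boundary points -/

theorem integerLattice_add_mem {d : ℕ} {x y : Fin d → ℝ} (hx : x ∈ integerLattice d)
    (hy : y ∈ integerLattice d) : x + y ∈ integerLattice d := by
  obtain ⟨z, rfl⟩ := hx
  obtain ⟨w, rfl⟩ := hy
  exact ⟨z + w, by ext i; simp⟩

theorem integerLattice_neg_mem {d : ℕ} {x : Fin d → ℝ} (hx : x ∈ integerLattice d) :
    -x ∈ integerLattice d := by
  obtain ⟨z, rfl⟩ := hx
  exact ⟨-z, by ext i; simp⟩

theorem zero_mem_integerLattice (d : ℕ) : (0 : Fin d → ℝ) ∈ integerLattice d :=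
  ⟨0, by ext i; simp⟩

namespace IsConvexLatticePolytope

section

variable {d : ℕ} {P : Set (Fin d → ℝ)}

theorem convex (hP : IsConvexLatticePolytope P) : Convex ℝ P := by
  obtain ⟨V, -, -, rfl⟩ := hP
  exact convex_convexHull ℝ V

theorem isCompact (hP : IsConvexLatticePolytope P) : IsCompact P := by
  obtain ⟨V, hV, -, rfl⟩ := hP
  exact hV.isCompact_convexHull (𝕜 := ℝ)

/-- A nonzero linear functional is maximized over a lattice polytope at a lattice point of the
boundary. -/
theorem exists_frontier_max (hP : IsConvexLatticePolytope P) (hne : P.Nonempty) {y : Fin d → ℝ}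
    (hy : y ≠ 0) : ∃ w ∈ frontier P ∩ integerLattice d, ∀ x ∈ P, x ⬝ᵥ y ≤ w ⬝ᵥ y := by
  have hcl := hP.isCompact.isClosed
  obtain ⟨V, hV, hVL, rfl⟩ := hP
  obtain ⟨w, hw, hmax⟩ := hV.exists_maximalFor (fun x => x ⬝ᵥ y) V (convexHull_nonempty_iff.1 hne)
  have hle : ∀ x ∈ convexHull ℝ V, x ⬝ᵥ y ≤ w ⬝ᵥ y := by
    have hconv : Convex ℝ {x : Fin d → ℝ | x ⬝ᵥ y ≤ w ⬝ᵥ y} :=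
      convex_halfSpace_le ⟨fun a c => add_dotProduct a c y, fun r a => smul_dotProduct r a y⟩ _
    exact fun x hx => convexHull_min (fun x hx => (le_total (x ⬝ᵥ y) (w ⬝ᵥ y)).elim id
      fun h => hmax hx h) hconv hx
  refine ⟨w, ⟨⟨subset_closure (subset_convexHull ℝ V hw), fun hint => ?_⟩, hVL hw⟩, hle⟩
  have hc : Continuous fun ε : ℝ => w + ε • y := by fun_prop
  have h0 : Tendsto (fun ε : ℝ => w + ε • y) (𝓝[>] 0) (𝓝 w) := by
    simpa using (hc.tendsto 0).mono_left nhdsWithin_le_nhds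
  obtain ⟨ε, h1, hε⟩ := ((h0.eventually (mem_interior_iff_mem_nhds.1 hint)).and
    self_mem_nhdsWithin).exists
  have h2 := hle _ h1
  rw [add_dotProduct, smul_dotProduct, smul_eq_mul] at h2
  have h3 : 0 < y ⬝ᵥ y := lt_of_le_of_ne (Finset.sum_nonneg fun i _ => mul_self_nonneg _)
    fun h => hy (dotProduct_self_eq_zero.1 h.symm)
  have := mul_pos (show 0 < ε from hε) h3
  linarith

/-- Translation by a lattice vector. -/
theorem translate (hP : IsConvexLatticePolytope P) {p : Fin d → ℝ} (hp : p ∈ integerLattice d) :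
    IsConvexLatticePolytope (p +ᵥ P) := by
  obtain ⟨V, hV, hVL, rfl⟩ := hP
  refine ⟨p +ᵥ V, hV.vadd_set, ?_, (convexHull_vadd p V).symm⟩
  rintro _ ⟨x, hx, rfl⟩
  exact integerLattice_add_mem hp (hVL hx)

end

variable {P : Set (Fin 3 → ℝ)} {b : ℕ} {v : Fin b → Fin 3 → ℝ}

theorem exists_dotProduct_le (hP : IsConvexLatticePolytope P)
    (hv : Set.range v = frontier P ∩ integerLattice 3) {x : Fin 3 → ℝ} (hx : x ∈ P)
    (y : Fin 3 → ℝ) : ∃ s, ∀ x ∈ P, x ⬝ᵥ y ≤ v s ⬝ᵥ y := by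
  by_cases hy : y = 0
  · obtain ⟨w, hw, -⟩ := hP.exists_frontier_max ⟨x, hx⟩ (one_ne_zero (α := Fin 3 → ℝ))
    rw [← hv] at hw
    obtain ⟨s, -⟩ := hw
    exact ⟨s, by simp [hy]⟩
  · obtain ⟨w, hw, hle⟩ := hP.exists_frontier_max ⟨x, hx⟩ hy
    rw [← hv] at hw
    obtain ⟨s, rfl⟩ := hw
    exact ⟨s, hle⟩

theorem positivelySpans (hP : IsConvexLatticePolytope P)
    (hv : Set.range v = frontier P ∩ integerLattice 3) (h0 : 0 ∈ interior P) :
    PositivelySpans v := by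
  obtain ⟨r, hr, hball⟩ := Metric.nhds_basis_closedBall.mem_iff.1 (mem_interior_iff_mem_nhds.1 h0)
  refine ⟨r, hr, fun x hx y => ?_⟩
  obtain ⟨s, hs⟩ := hP.exists_dotProduct_le hv (interior_subset h0) y
  refine ⟨s, hs x (hball ?_)⟩
  rw [mem_closedBall_zero_iff, pi_norm_le_iff_of_nonneg hr.le]
  exact hx

theorem mem_of_range_eq (hP : IsConvexLatticePolytope P)
    (hv : Set.range v = frontier P ∩ integerLattice 3) (s : Fin b) : v s ∈ P :=
  hP.isCompact.isClosed.frontier_subset (hv.subset ⟨s, rfl⟩).1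

/-- A nonnegative combination of points of `P` with weight sum below 1 is the origin or a point of
`P` shrunk towards it, hence interior. -/
theorem onBoundary (hP : IsConvexLatticePolytope P)
    (hv : Set.range v = frontier P ∩ integerLattice 3) (h0 : 0 ∈ interior P) :
    OnBoundary v := by
  intro s w c hc hs
  by_contra! hlt
  have hnot : v s ∉ interior P := (hv.subset ⟨s, rfl⟩).1.2
  rcases (Finset.sum_nonneg fun i _ => hc i : 0 ≤ ∑ i, c i).eq_or_lt with h | h
  · have h1 := (Finset.sum_eq_zero_iff_of_nonneg fun i _ => hc i).1 h.symm
    rw [Finset.sum_eq_zero fun i hi => by rw [h1 i hi, zero_smul]] at hs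
    exact hnot (hs ▸ h0)
  · refine hnot (hP.convex.openSegment_interior_self_subset_interior h0
      (hP.convex.centerMass_mem (t := Finset.univ) (w := c) (z := fun i => v (w i))
        (fun i _ => hc i) h fun i _ => hP.mem_of_range_eq hv _)
      ⟨1 - ∑ i, c i, ∑ i, c i, sub_pos.2 hlt, h, by ring, ?_⟩)
    rw [smul_zero, zero_add, Finset.centerMass, smul_inv_smul₀ h.ne', hs]

end IsConvexLatticePolytope

/-! ### Pyramids from the origin and assembly -/

section Pyramid

variable {b : ℕ} {v : Fin b → Fin 3 → ℝ}

/-- The tetrahedron with apex at the origin over the triangle indexed by `t`. -/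
def pyramidMatrix (v : Fin b → Fin 3 → ℝ) (t : Fin 3 → Fin b) : Matrix (Fin 4) (Fin 4) ℝ :=
  Matrix.of (vecCons (homogenize 0) fun i => homogenize (v (t i)))

theorem det_pyramidMatrix (t : Fin 3 → Fin b) :
    (pyramidMatrix v t).det = (coneMatrix v t).det := by
  rw [det_succ_row_zero, Fin.sum_univ_succ, Finset.sum_eq_zero fun j _ => ?_]
  · simp only [pyramidMatrix, homogenize, of_apply, cons_val_zero, Fin.val_zero, pow_zero, one_mul,
      add_zero]
    rfl
  · simp [pyramidMatrix, homogenize]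

theorem coord_pyramidMatrix_nonneg {t : Fin 3 → Fin b} (ht : (coneMatrix v t).det ≠ 0)
    {x : Fin 3 → ℝ} (hx : 0 ≤ coord (coneMatrix v t) x)
    (hs : ∑ i, coord (coneMatrix v t) x i ≤ 1) :
    0 ≤ coord (pyramidMatrix v t) (homogenize x) := by
  have h1 : (vecCons (1 - ∑ i, coord (coneMatrix v t) x i) (coord (coneMatrix v t) x))
      ᵥ* pyramidMatrix v t = homogenize x := by
    rw [vecMul_eq_sum, Fin.sum_univ_succ]
    ext j
    rw [Pi.add_apply, Finset.sum_apply]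
    refine Fin.cases ?_ (fun j => ?_) j
    · simp [pyramidMatrix, homogenize]
    · have := congrFun (sum_coord_smul_cone ht x) j
      rw [Finset.sum_apply] at this
      simpa [pyramidMatrix, homogenize] using this
  rw [← h1, coord_vecMul (by rwa [det_pyramidMatrix])]
  exact fun i => Fin.cases (sub_nonneg.2 hs) hx i

end Pyramid

/-- The volume bound for lattice polytopes that have the origin in their interior. -/
theorem volume_bound_of_zero_mem_interior {P : Set (Fin 3 → ℝ)} (hP : IsConvexLatticePolytope P)
    {b k : ℕ} (hb : (frontier P ∩ integerLattice 3).encard = (b : ℕ∞))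
    (hk : (interior P ∩ integerLattice 3).encard = (k : ℕ∞)) (h0 : 0 ∈ interior P) :
    2 * (b : ℝ) + 3 * k - 7 ≤ 6 * (volume P).toReal := by
  classical
  have hbf : (frontier P ∩ integerLattice 3).Finite := Set.finite_of_encard_eq_coe hb
  have hkf : (interior P ∩ integerLattice 3).Finite := Set.finite_of_encard_eq_coe hk
  rw [hbf.encard_eq_coe_toFinset_card, Nat.cast_inj] at hb
  rw [hkf.encard_eq_coe_toFinset_card, Nat.cast_inj] at hk
  let v : Fin b → Fin 3 → ℝ := fun s => (hbf.toFinset.equivFinOfCardEq hb).symm s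
  have hinj : Function.Injective v := Subtype.val_injective.comp (Equiv.injective _)
  have hv : Set.range v = frontier P ∩ integerLattice 3 := by
    ext x
    constructor
    · rintro ⟨s, rfl⟩
      exact hbf.mem_toFinset.1 ((hbf.toFinset.equivFinOfCardEq hb).symm s).2
    · intro hx
      exact ⟨hbf.toFinset.equivFinOfCardEq hb ⟨x, hbf.mem_toFinset.2 hx⟩, by simp [v]⟩
  have hspan := hP.positivelySpans hv h0
  obtain ⟨h, hpos, hgen, hcell⟩ := exists_heights hinj (hP.onBoundary hv h0)
  have hcount := two_mul_le_card_cells hspan hpos hgen fun t ht => (hcell t ht).2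
  have hvol := sum_abs_det_cells_le hgen hP.convex (interior_subset h0) (hP.mem_of_range_eq hv)
    hP.isCompact.measure_ne_top
  have hcov : CoversByTetrahedra P (insert 0 (Set.range v))
      fun t : {t // t ∈ cells v h} => pyramidMatrix v t.1 := by
    refine ⟨fun t => ?_, fun t j => ?_, fun x hx => ?_⟩
    · rw [det_pyramidMatrix]
      exact (mem_cells.1 t.2).det_ne_zero
    · refine Fin.cases ⟨0, Set.mem_insert _ _, rfl⟩ (fun i => ?_) j
      exact ⟨v (t.1 i), Set.mem_insert_of_mem _ ⟨_, rfl⟩, rfl⟩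
    · obtain ⟨t, ht, hxt⟩ := exists_cell_coord_nonneg hspan hpos hgen x
      refine ⟨⟨t, mem_cells.2 ht⟩, coord_pyramidMatrix_nonneg ht.det_ne_zero hxt ?_⟩
      -- The coordinate sum is a linear functional, so its maximum on `P` is attained at a boundary
      -- lattice point, where it is at most 1. Hence the pyramid, not just the cone, contains `x`.
      have hlin : ∀ z, ∑ i, coord (coneMatrix v t) z i = z ⬝ᵥ ((coneMatrix v t)⁻¹ *ᵥ 1) :=
        fun z => by rw [dotProduct_mulVec, dotProduct_one]; rfl
      obtain ⟨s, hs⟩ := hP.exists_dotProduct_le hv hx ((coneMatrix v t)⁻¹ *ᵥ 1)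
      have h1 := (hcell t ht).1 s
      rw [hlin] at h1 ⊢
      exact (hs x hx).trans h1
  have hsub : ((hkf.toFinset.erase 0 : Finset (Fin 3 → ℝ)) : Set (Fin 3 → ℝ))
      ⊆ interior P ∩ integerLattice 3 := fun x hx => by
    simpa using Finset.mem_of_mem_erase hx
  obtain ⟨κ, _, A, hA, hdet, hcard⟩ := CoversByTetrahedra.exists_refinement (hkf.toFinset.erase 0)
    _ _ _ hcov (hsub.trans Set.inter_subset_left) (by
      refine Set.disjoint_insert_right.2 ⟨by simp, ?_⟩
      rw [hv]
      exact (disjoint_interior_frontier.mono Set.inter_subset_left Set.inter_subset_left).mono_left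
        hsub)
  have hL := hA.card_le_sum_abs_det (Set.union_subset (hsub.trans Set.inter_subset_right)
    (Set.insert_subset (zero_mem_integerLattice 3) (hv ▸ Set.inter_subset_right)))
  rw [hdet] at hL
  simp only [det_pyramidMatrix] at hL
  rw [Finset.sum_coe_sort (cells v h) fun t => |(coneMatrix v t).det|] at hL
  have h1 : (hkf.toFinset.erase 0).card + 1 = k := by
    rw [Finset.card_erase_add_one (hkf.mem_toFinset.2 ⟨h0, zero_mem_integerLattice 3⟩), hk]
  rw [Fintype.card_coe] at hcard
  -- The 7 is 4 from the cone count plus 3 for the origin, which is not inserted.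
  have h2 : (2 * b + 3 * k : ℝ) ≤ Fintype.card κ + 7 := by
    exact_mod_cast (by omega : 2 * b + 3 * k ≤ Fintype.card κ + 7)
  linarith

theorem mainTheorem8 (P : Set (Fin 3 → ℝ)) (hP : IsConvexLatticePolytope P) (b k : ℕ)
    (hb : (frontier P ∩ integerLattice 3).encard = (b : ℕ∞))
    (hk : (interior P ∩ integerLattice 3).encard = (k : ℕ∞)) (hk1 : 1 ≤ k) :
    (MeasureTheory.volume P).toReal ≥ (2 * (b : ℝ) + 3 * (k : ℝ) - 7) / 6 := by
  obtain ⟨p, hpi, hpL⟩ : (interior P ∩ integerLattice 3).Nonempty := by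
    rw [← Set.encard_pos, hk]
    exact_mod_cast hk1
  let e : (Fin 3 → ℝ) ≃ₜ (Fin 3 → ℝ) := Homeomorph.addLeft (-p)
  have he : ∀ x, e x = -p + x := fun _ => rfl
  have hL : e '' integerLattice 3 = integerLattice 3 := by
    ext x
    constructor
    · rintro ⟨y, hy, rfl⟩
      exact integerLattice_add_mem (integerLattice_neg_mem hpL) hy
    · exact fun hx => ⟨p + x, integerLattice_add_mem hpL hx, by rw [he, neg_add_cancel_left]⟩
  have hQ : IsConvexLatticePolytope (e '' P) := hP.translate (integerLattice_neg_mem hpL)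
  have h0 : 0 ∈ interior (e '' P) := by
    rw [← e.image_interior]
    exact ⟨p, hpi, neg_add_cancel p⟩
  have hvol : volume (e '' P) = volume P := measure_vadd volume (-p) P
  have h1 := volume_bound_of_zero_mem_interior hQ (b := b) (k := k)
    (by rw [← e.image_frontier, ← hL, ← Set.image_inter e.injective, e.injective.encard_image, hb])
    (by rw [← e.image_interior, ← hL, ← Set.image_inter e.injective, e.injective.encard_image, hk])
    h0
  rw [hvol] at h1
  linarith
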